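/- Let $G$ be a graph, $H$ a spanning subgraph of $G$, and $\lambda\ge 2$ an integer. A $\lambda$-backbone coloring of $G$ with backbone $H$ is a map $c\colon V(G)\to\{1,2,3,\dots\}$ such that $c(u)\ne c(v)$ for every edge $uv$ of $G$ and $|c(u)-c(v)|\ge\lambda$ for every edge $uv$ of $H$; $BBC_\lambda(G,H)$ is the smallest $k$ for which such a $c$ with values in $\{1,\dots,k\}$ exists. Define rooted trees $T_N^F$ ($N\ge1$), the Fibonacci trees, by $T_1^F=T_2^F=K_1$ and, for $N\ge3$, let $T_N^F$ consist of a root $u_1$ whose only child is $u_2$, where $u_2$ has exactly two children, which are the roots of a copy of $T_{N-1}^F$ and of a copy of $T_{N-2}^F$. Let $F_N$ be the Fibonacci numbers ($F_1=F_2=1$) and $\varphi=(1+\sqrt5)/2$. Theorem. For every $N\ge 96$ the graph $T_N^F$ is a tree on $n=3F_N-2$ vertices with maximum degree $\Delta(T_N^F)=3$, and for $\lambda=\lfloor n/2\rfloor$, where $K_n$ is the complete graph on the vertex set of $T_N^F$, $$BBC_\lambda(K_n,T_N^F)\ \ge\ \max\{n,2\lambda\}+\tfrac1{48}\log_\varphi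 n-3 .$$ The trees $T_N^F$, $N\ge96$, are pairwise non-isomorphic, so they form an infinite family. Consequently an additive loss of order $\log n$ is sometimes unavoidable even for maximum degree $3$: there are a constant $C>0$ and an $N_0$ such that for all $N\ge N_0$, with $n=|V(T_N^F)|$ and $\lambda=\lfloor n/2\rfloor$, $BBC_\lambda(K_n,T_N^F)\ge\max\{n,2\lambda\}+C\log n$. -/

import Mathlib

/-- `c` is a `lam`-backbone colouring (with positive integers) of `G` with backbone `H`, where `G`
and `H` are graphs on the same vertex set. -/
structure IsBackboneColoring {V : Type*} (G H : SimpleGraph V) (lam : ℕ) (c : V → ℕ) : Prop where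
  pos : ∀ v, 1 ≤ c v
  proper : ∀ u v, G.Adj u v → c u ≠ c v
  backbone : ∀ u v, H.Adj u v → (lam : ℤ) ≤ |(c u : ℤ) - (c v : ℤ)|

/-- The `lam`-backbone colouring number of `G` with backbone `H`: the smallest `k` such that there is
a `lam`-backbone colouring of `G` with backbone `H` using colours from `{1, …, k}` only. -/
noncomputable def backboneChromaticNumber {V : Type*} (G H : SimpleGraph V) (lam : ℕ) : ℕ :=
  sInf {k : ℕ | ∃ c : V → ℕ, IsBackboneColoring G H lam c ∧ ∀ v, c v ≤ k}

/-- On a finite vertex set, with `H` a subgraph of `G`, the minimum defining the backbone colouring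
number is attained. -/
theorem backboneChromaticNumber_attained {V : Type*} [Finite V] (G H : SimpleGraph V) (h : H ≤ G)
    (lam : ℕ) : ∃ c : V → ℕ, IsBackboneColoring G H lam c ∧
      ∀ v, c v ≤ backboneChromaticNumber G H lam := by
  apply Nat.sInf_mem (s := {k : ℕ | ∃ c : V → ℕ, IsBackboneColoring G H lam c ∧ ∀ v, c v ≤ k})
  obtain ⟨n, ⟨e⟩⟩ := Finite.exists_equiv_fin V
  have key : ∀ u v, u ≠ v →
      ((lam + 1 : ℕ) : ℤ) ≤ |((1 + (lam + 1) * (e u : ℕ) : ℕ) : ℤ)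
        - ((1 + (lam + 1) * (e v : ℕ) : ℕ) : ℤ)| := by
    intro u v huv
    have h1 : ((e u : ℕ) : ℤ) - ((e v : ℕ) : ℤ) ≠ 0 := by
      intro h0
      exact huv (e.injective (Fin.ext (by omega)))
    have h2 : (1 : ℤ) ≤ |((e u : ℕ) : ℤ) - ((e v : ℕ) : ℤ)| := Int.one_le_abs h1
    have h3 : ((1 + (lam + 1) * (e u : ℕ) : ℕ) : ℤ) - ((1 + (lam + 1) * (e v : ℕ) : ℕ) : ℤ)
        = ((lam + 1 : ℕ) : ℤ) * (((e u : ℕ) : ℤ) - ((e v : ℕ) : ℤ)) := by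
      push_cast
      ring
    rw [h3, abs_mul, Nat.abs_cast]
    exact le_mul_of_one_le_right (by positivity) h2
  refine ⟨1 + (lam + 1) * n, fun v => 1 + (lam + 1) * (e v : ℕ), ⟨fun v => by simp, ?_, ?_⟩, ?_⟩
  · intro u v huv heq
    have := key u v huv.ne
    rw [heq, sub_self, abs_zero] at this
    omega
  · intro u v huv
    have := key u v (h huv).ne
    push_cast at this ⊢
    linarith
  · intro v
    exact Nat.add_le_add_left (Nat.mul_le_mul_left _ (e v).isLt.le) 1

/-- A finite graph with a distinguished vertex, its root. -/
structure RootedGraph where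
  V : Type
  fintypeV : Fintype V
  graph : SimpleGraph V
  root : V

namespace RootedGraph

instance (A : RootedGraph) : Fintype A.V := A.fintypeV

noncomputable instance (A : RootedGraph) : DecidableRel A.graph.Adj := Classical.decRel _

/-- The one-vertex rooted graph `K₁`. -/
def single : RootedGraph where
  V := Unit
  fintypeV := inferInstance
  graph := ⊥
  root := ()

/-- The directed edges, from parent to child, of the rooted graph `graft A B` below. Its vertices are
`u₁ = Sum.inl 0`, `u₂ = Sum.inl 1`, and the vertices of a copy of `A` and of a copy of `B`. -/
inductive GraftEdge (A B : RootedGraph) :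
    Fin 2 ⊕ (A.V ⊕ B.V) → Fin 2 ⊕ (A.V ⊕ B.V) → Prop
  | top : GraftEdge A B (Sum.inl 0) (Sum.inl 1)
  | rootLeft : GraftEdge A B (Sum.inl 1) (Sum.inr (Sum.inl A.root))
  | rootRight : GraftEdge A B (Sum.inl 1) (Sum.inr (Sum.inr B.root))
  | left {x y : A.V} : A.graph.Adj x y →
      GraftEdge A B (Sum.inr (Sum.inl x)) (Sum.inr (Sum.inl y))
  | right {x y : B.V} : B.graph.Adj x y →
      GraftEdge A B (Sum.inr (Sum.inr x)) (Sum.inr (Sum.inr y))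

/-- The rooted graph with root `u₁` whose only child is `u₂`, where the two subtrees of `u₂` are
copies of `A` and of `B`, attached to `u₂` by their roots. -/
def graft (A B : RootedGraph) : RootedGraph where
  V := Fin 2 ⊕ (A.V ⊕ B.V)
  fintypeV := inferInstance
  graph := SimpleGraph.fromRel (GraftEdge A B)
  root := Sum.inl 0

end RootedGraph

/-- The `N`-th Fibonacci tree, for `N ≥ 1` (the value at `0` is a dummy). -/
def fibonacciTree : ℕ → RootedGraph
  | 0 => RootedGraph.single
  | 1 => RootedGraph.single
  | 2 => RootedGraph.single
  | N + 3 => RootedGraph.graft (fibonacciTree (N + 2)) (fibonacciTree (N + 1))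

/-! A backbone coloring of the complete graph with colors in {1,…,k} is injective. With λ = ⌊n/2⌋,
give sign +1 to the λ lowest colors, -1 to the λ highest and 0 to the rest. Two colors in the same
extreme block differ by less than λ, so signs alternate along tree edges apart from the m ≤ k - n +
1 exceptional vertices of sign 0, and the total sign is at most m in absolute value.

The Fibonacci tree forbids this for small m. Without exceptional vertices, u₁ and u₂ cancel and both
subtrees start with the sign of u₁, so the total is ±F_N by the Fibonacci recurrence. Each
exceptional vertex can flip the subtrees below it, which changes the total by even multiples of
smaller Fibonacci numbers (`hasFibExpansion_graft`). Near balance thus yields a relation ∑ bᵢFᵢ = 0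
of weight O(m) with b_N = ±1 and bᵢ even for 2 ≤ i < N.

Such a relation has weight at least linear in N (`length_le_of_fib_relation`): each tail, as an
element of ℤ[φ], is nonzero mod 2, so its norm is at least 1, while the relation bounds the tail and
its conjugate by geometrically decaying sums of the |bᵢ|. Hence m, and so k - n, is of order N, that
is, of order log n. -/

section Auxiliary

open Finset Real

/-! ### Integer relations among Fibonacci numbers, via norms in ℤ[φ] -/

theorem norm_form_ne_zero {x y : ℤ} (h : ¬ (Even x ∧ Even y)) : x ^ 2 + x * y - y ^ 2 ≠ 0 := by
  intro h0
  -- Modulo 2 the form is x² + xy + y², whose only zero is (0, 0).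
  have h1 : Even (x ^ 2 + x * y - y ^ 2) := by rw [h0]; exact Even.zero
  simp only [Int.even_sub, Int.even_add, Int.even_mul, Int.even_pow] at h1
  tauto

theorem goldenRatio_pow_eq_fib (n : ℕ) :
    goldenRatio ^ n = (Nat.fib n : ℝ) * goldenRatio + ((Nat.fib (n + 1) : ℝ) - Nat.fib n) := by
  induction n with
  | zero => simp
  | succ k ih =>
    rw [pow_succ, ih, Nat.fib_add_two]
    push_cast
    linear_combination (Nat.fib k : ℝ) * goldenRatio_sq

theorem goldenConj_pow_eq_fib (n : ℕ) :
    goldenConj ^ n = (Nat.fib n : ℝ) * goldenConj + ((Nat.fib (n + 1) : ℝ) - Nat.fib n) := by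
  induction n with
  | zero => simp
  | succ k ih =>
    rw [pow_succ, ih, Nat.fib_add_two]
    push_cast
    linear_combination (Nat.fib k : ℝ) * goldenConj_sq

/-- A combination of powers of the golden ratio whose coefficients are even, except that the last
one is odd, is a nonzero element of `ℤ[φ]`, so its norm has absolute value at least one. -/
theorem one_le_abs_mul_conj (c : ℕ → ℤ) (n : ℕ) (hn : Odd (c n)) (he : ∀ i < n, Even (c i)) :
    1 ≤ |∑ i ∈ range (n + 1), (c i : ℝ) * goldenRatio ^ i| *
      |∑ i ∈ range (n + 1), (c i : ℝ) * goldenConj ^ i| := by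
  set x : ℤ := ∑ i ∈ range (n + 1), c i * ((Nat.fib (i + 1) : ℤ) - Nat.fib i) with hx
  set y : ℤ := ∑ i ∈ range (n + 1), c i * (Nat.fib i : ℤ) with hy
  have h1 : ∑ i ∈ range (n + 1), (c i : ℝ) * goldenRatio ^ i = y * goldenRatio + x := by
    rw [hx, hy]
    push_cast
    rw [sum_mul, ← sum_add_distrib]
    refine sum_congr rfl fun i _ => ?_
    rw [goldenRatio_pow_eq_fib]
    ring
  have h2 : ∑ i ∈ range (n + 1), (c i : ℝ) * goldenConj ^ i = y * goldenConj + x := by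
    rw [hx, hy]
    push_cast
    rw [sum_mul, ← sum_add_distrib]
    refine sum_congr rfl fun i _ => ?_
    rw [goldenConj_pow_eq_fib]
    ring
  have h3 : ((y : ℝ) * goldenRatio + x) * (y * goldenConj + x)
      = ((x ^ 2 + x * y - y ^ 2 : ℤ) : ℝ) := by
    push_cast
    linear_combination (y : ℝ) ^ 2 * goldenRatio_mul_goldenConj +
      (x : ℝ) * y * goldenRatio_add_goldenConj
  have h4 : ¬ (Even x ∧ Even y) := by
    rintro ⟨hxe, hye⟩
    -- Modulo 2 only the term φⁿ survives, so x and y both even would make the consecutive, hence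
    -- coprime, F_n and F_{n+1} both even.
    have key : ∀ f : ℕ → ℤ, Even (∑ i ∈ range (n + 1), c i * f i) → Even (f n) := by
      intro f hf
      rw [sum_range_succ, Int.even_add] at hf
      have : Even (∑ i ∈ range n, c i * f i) :=
        even_sum _ fun i hi => (he i (mem_range.1 hi)).mul_right _
      have h := hf.1 this
      rw [Int.even_mul] at h
      exact h.resolve_left (Int.not_even_iff_odd.2 hn)
    have hb := key _ hye
    have ha := key _ hxe
    have ha' : Even ((Nat.fib (n + 1) : ℕ) : ℤ) := by
      rw [Int.even_sub] at ha
      exact ha.2 hb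
    have hd := Nat.dvd_gcd ((Int.even_coe_nat _).1 hb).two_dvd ((Int.even_coe_nat _).1 ha').two_dvd
    rw [(Nat.fib_coprime_fib_succ n)] at hd
    omega
  rw [h1, h2, ← abs_mul, h3, ← Int.cast_abs]
  exact_mod_cast Int.one_le_abs (norm_form_ne_zero h4)

theorem inv_goldenRatio_eq : goldenRatio⁻¹ = |goldenConj| := by
  rw [inv_goldenRatio, abs_of_neg goldenConj_neg]

theorem abs_goldenConj_le : |goldenConj| ≤ 2 / 3 := by
  rw [abs_of_neg goldenConj_neg]
  nlinarith [goldenConj_sq, goldenConj_neg, neg_one_lt_goldenConj]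

theorem geom_sum_le_three {q : ℝ} (h0 : 0 ≤ q) (h1 : q ≤ 2 / 3) (n : ℕ) :
    ∑ k ∈ range n, q ^ k ≤ 3 := by
  have h := geom_sum_mul_neg q n
  have hs : 0 ≤ ∑ k ∈ range n, q ^ k := sum_nonneg fun _ _ => pow_nonneg h0 _
  nlinarith [pow_nonneg h0 n]

theorem sum_pow_dist_le_six {q : ℝ} (h0 : 0 ≤ q) (h1 : q ≤ 2 / 3) (i n : ℕ) :
    ∑ k ∈ range n, q ^ (Nat.dist k i) ≤ 6 := by
  have hsub : range n ⊆ range (i + n) := range_mono (by omega)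
  refine (sum_le_sum_of_subset_of_nonneg hsub fun _ _ _ => pow_nonneg h0 _).trans ?_
  rw [sum_range_add]
  have ha : ∑ k ∈ range i, q ^ (Nat.dist k i) ≤ ∑ k ∈ range i, q ^ k := by
    rw [← sum_range_reflect (fun k => q ^ k) i]
    refine sum_le_sum fun k hk => pow_le_pow_of_le_one h0 (by linarith) ?_
    have := mem_range.1 hk
    rw [Nat.dist_eq_sub_of_le this.le]
    omega
  have hb : ∑ k ∈ range n, q ^ (Nat.dist (i + k) i) = ∑ k ∈ range n, q ^ k := by
    refine sum_congr rfl fun k _ => ?_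
    rw [Nat.dist_comm, Nat.dist_eq_sub_of_le (by omega)]
    congr 1
    omega
  linarith [geom_sum_le_three h0 h1 i, geom_sum_le_three h0 h1 n]

/-- The tail r = ∑_{i ≥ k} bᵢφ^{i-k} and its conjugate r' satisfy |r||r'| ≥ 1, so |r| + |r'| ≥ 2.
The conjugate decays by itself; r is rewritten through the terms below k, where the powers of φ are
negative. -/
theorem two_le_weighted_sum (b : ℕ → ℤ) (N : ℕ) (hodd : Odd (b N))
    (heven : ∀ i, 2 ≤ i → i < N → Even (b i))
    (hsum : ∑ i ∈ range (N + 1), b i * (Nat.fib i : ℤ) = 0) (k : ℕ) (hk : 2 ≤ k) (hkN : k ≤ N) :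
    2 ≤ ∑ i ∈ range (N + 1), |(b i : ℝ)| * (|goldenConj| ^ k + |goldenConj| ^ Nat.dist k i) := by
  obtain ⟨n, rfl⟩ := Nat.exists_eq_add_of_le hkN
  set q := |goldenConj| with hq
  have hq0 : 0 ≤ q := abs_nonneg _
  have hq1 : q ≤ 1 := abs_goldenConj_le.trans (by norm_num)
  have hqφ : q * goldenRatio = 1 := by
    rw [hq, ← inv_goldenRatio_eq, inv_mul_cancel₀ goldenRatio_ne_zero]
  set r := ∑ i ∈ range (n + 1), (b (k + i) : ℝ) * goldenRatio ^ i with hr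
  set r' := ∑ i ∈ range (n + 1), (b (k + i) : ℝ) * goldenConj ^ i with hr'
  have hnorm : 1 ≤ |r| * |r'| := one_le_abs_mul_conj (fun i => b (k + i)) n hodd
    fun i hi => heven _ (by omega) (by omega)
  have htwo : 2 ≤ |r| + |r'| := by
    nlinarith [sq_nonneg (|r| - |r'|), abs_nonneg r, abs_nonneg r']
  -- By Binet, ∑ bᵢFᵢ = 0 says that ∑ bᵢφⁱ is fixed by conjugation.
  have hUU : ∑ i ∈ range (k + n + 1), (b i : ℝ) * goldenRatio ^ i =
      ∑ i ∈ range (k + n + 1), (b i : ℝ) * goldenConj ^ i := by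
    have h : (∑ i ∈ range (k + n + 1), (b i : ℝ) * Nat.fib i) * (goldenRatio - goldenConj) = 0 := by
      have : (∑ i ∈ range (k + n + 1), (b i : ℝ) * Nat.fib i) = 0 := by exact_mod_cast hsum
      rw [this, zero_mul]
    rw [sum_mul] at h
    rw [← sub_eq_zero, ← sum_sub_distrib, ← h]
    refine sum_congr rfl fun i _ => ?_
    rw [goldenRatio_pow_eq_fib, goldenConj_pow_eq_fib]
    ring
  have hsplit : r = ∑ i ∈ range (k + n + 1), (b i : ℝ) * goldenConj ^ i * q ^ k -
      ∑ i ∈ range k, (b i : ℝ) * q ^ (k - i) := by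
    rw [← sum_mul, ← hUU, add_assoc, sum_range_add, add_mul, sum_mul, sum_mul]
    have e1 : ∑ i ∈ range k, (b i : ℝ) * goldenRatio ^ i * q ^ k =
        ∑ i ∈ range k, (b i : ℝ) * q ^ (k - i) := by
      refine sum_congr rfl fun i hi => ?_
      have hki : k = (k - i) + i := by have := mem_range.1 hi; omega
      have : goldenRatio ^ i * q ^ k = q ^ (k - i) := by
        conv_lhs => rw [hki, pow_add]
        rw [mul_left_comm, ← mul_pow, mul_comm goldenRatio, hqφ, one_pow, mul_one]
      rw [mul_assoc, this]
    have e2 : ∑ i ∈ range (n + 1), (b (k + i) : ℝ) * goldenRatio ^ (k + i) * q ^ k = r := by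
      refine sum_congr rfl fun i _ => ?_
      have : goldenRatio ^ (k + i) * q ^ k = goldenRatio ^ i := by
        rw [pow_add, mul_right_comm, ← mul_pow, mul_comm goldenRatio, hqφ, one_pow, one_mul]
      rw [mul_assoc, this]
    rw [e1, e2]
    ring
  have hr_le : |r| ≤ ∑ i ∈ range (k + n + 1), |(b i : ℝ)| * q ^ k +
      ∑ i ∈ range k, |(b i : ℝ)| * q ^ Nat.dist k i := by
    rw [hsplit]
    refine (abs_sub _ _).trans (add_le_add ?_ ?_)
    · refine (abs_sum_le_sum_abs _ _).trans (sum_le_sum fun i _ => ?_)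
      rw [abs_mul, abs_mul, abs_pow, abs_of_nonneg (pow_nonneg hq0 k), ← hq]
      refine mul_le_mul_of_nonneg_right ?_ (pow_nonneg hq0 k)
      exact mul_le_of_le_one_right (abs_nonneg _) (pow_le_one₀ hq0 hq1)
    · refine (abs_sum_le_sum_abs _ _).trans (sum_le_sum fun i hi => ?_)
      rw [abs_mul, abs_of_nonneg (pow_nonneg hq0 _), Nat.dist_comm,
        Nat.dist_eq_sub_of_le (mem_range.1 hi).le]
  have hr'_le : |r'| ≤ ∑ i ∈ range (n + 1), |(b (k + i) : ℝ)| * q ^ Nat.dist k (k + i) := by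
    refine (abs_sum_le_sum_abs _ _).trans (sum_le_sum fun i hi => ?_)
    rw [abs_mul, abs_pow, Nat.dist_eq_sub_of_le (by omega), Nat.add_sub_cancel_left]
  have hcomb : ∑ i ∈ range (k + n + 1), |(b i : ℝ)| * (q ^ k + q ^ Nat.dist k i) =
      ∑ i ∈ range (k + n + 1), |(b i : ℝ)| * q ^ k +
      (∑ i ∈ range k, |(b i : ℝ)| * q ^ Nat.dist k i +
        ∑ i ∈ range (n + 1), |(b (k + i) : ℝ)| * q ^ Nat.dist k (k + i)) := by
    rw [← sum_range_add (fun i => |(b i : ℝ)| * q ^ Nat.dist k i), ← add_assoc,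
      ← sum_add_distrib]
    exact sum_congr rfl fun i _ => mul_add _ _ _
  linarith

/-- In an integer relation `∑ bᵢ Fᵢ = 0` whose last coefficient is odd and whose other coefficients
are even from index two on, the total weight `∑ |bᵢ|` grows linearly with the length. -/
theorem length_le_of_fib_relation (b : ℕ → ℤ) (N : ℕ) (hodd : Odd (b N))
    (heven : ∀ i, 2 ≤ i → i < N → Even (b i))
    (hsum : ∑ i ∈ range (N + 1), b i * (Nat.fib i : ℤ) = 0) :
    2 * ((N : ℤ) - 1) ≤ 9 * ∑ i ∈ range (N + 1), |b i| := by
  set q := |goldenConj| with hq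
  have hq0 : 0 ≤ q := abs_nonneg _
  have h1 : ∑ _k ∈ Ico 2 (N + 1), (2 : ℝ) ≤ ∑ k ∈ Ico 2 (N + 1),
      ∑ i ∈ range (N + 1), |(b i : ℝ)| * (q ^ k + q ^ Nat.dist k i) :=
    sum_le_sum fun k hk => two_le_weighted_sum b N hodd heven hsum k (mem_Ico.1 hk).1
      (by have := (mem_Ico.1 hk).2; omega)
  -- After exchanging the sums, each |bᵢ| has total weight at most 3 + 6 = 9: one geometric series
  -- in k, and one in the distance |k - i| on both sides of i.
  have h2 : ∑ k ∈ Ico 2 (N + 1), ∑ i ∈ range (N + 1), |(b i : ℝ)| * (q ^ k + q ^ Nat.dist k i) ≤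
      ∑ i ∈ range (N + 1), |(b i : ℝ)| * 9 := by
    rw [sum_comm]
    refine sum_le_sum fun i _ => ?_
    rw [← mul_sum]
    refine mul_le_mul_of_nonneg_left ?_ (abs_nonneg _)
    have hsub : Ico 2 (N + 1) ⊆ range (N + 1) := fun k hk => mem_range.2 (mem_Ico.1 hk).2
    refine (sum_le_sum_of_subset_of_nonneg hsub fun _ _ _ => by positivity).trans ?_
    rw [sum_add_distrib]
    linarith [geom_sum_le_three hq0 abs_goldenConj_le (N + 1),
      sum_pow_dist_le_six hq0 abs_goldenConj_le i (N + 1)]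
  rw [sum_const, Nat.card_Ico, nsmul_eq_mul] at h1
  have h3 : ((N : ℝ) - 1) ≤ ((N + 1 - 2 : ℕ) : ℝ) := by
    have : N ≤ (N + 1 - 2) + 1 := by omega
    have : (N : ℝ) ≤ ((N + 1 - 2 : ℕ) : ℝ) + 1 := by exact_mod_cast this
    linarith
  have h4 : 2 * ((N : ℝ) - 1) ≤ 9 * ∑ i ∈ range (N + 1), |(b i : ℝ)| := by
    rw [← sum_mul] at h2
    linarith
  exact_mod_cast h4

/-! ### Grafts of rooted graphs: adjacency, degrees and trees -/

namespace RootedGraph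

theorem card_graft (A B : RootedGraph) :
    Fintype.card (graft A B).V = 2 + (Fintype.card A.V + Fintype.card B.V) := by
  change Fintype.card (Fin 2 ⊕ (A.V ⊕ B.V)) = _
  simp

/-- The two top vertices of `graft A B`. -/
def graftTop (A B : RootedGraph) (i : Fin 2) : (graft A B).V := Sum.inl i

/-- The inclusion of the left subtree of `graft A B`. -/
def graftLeft (A B : RootedGraph) (x : A.V) : (graft A B).V := Sum.inr (Sum.inl x)

/-- The inclusion of the right subtree of `graft A B`. -/
def graftRight (A B : RootedGraph) (y : B.V) : (graft A B).V := Sum.inr (Sum.inr y)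

theorem graft_cases {A B : RootedGraph} {P : (graft A B).V → Prop}
    (top : ∀ i, P (graftTop A B i)) (left : ∀ x, P (graftLeft A B x))
    (right : ∀ y, P (graftRight A B y)) : ∀ v, P v
  | Sum.inl i => top i
  | Sum.inr (Sum.inl x) => left x
  | Sum.inr (Sum.inr y) => right y

theorem sum_graft {M : Type*} [AddCommMonoid M] (A B : RootedGraph) (f : (graft A B).V → M) :
    ∑ v, f v = f (graftTop A B 0) + f (graftTop A B 1) +
      (∑ x : A.V, f (graftLeft A B x) + ∑ y : B.V, f (graftRight A B y)) := by
  let g : Fin 2 ⊕ (A.V ⊕ B.V) → M := f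
  have h : ∑ v, g v = g (Sum.inl 0) + g (Sum.inl 1) +
      (∑ x : A.V, g (Sum.inr (Sum.inl x)) + ∑ y : B.V, g (Sum.inr (Sum.inr y))) := by
    rw [Fintype.sum_sum_type, Fintype.sum_sum_type, Fin.sum_univ_two]
  exact h

section Adjacency

variable (A B : RootedGraph)

theorem graft_adj (u v : Fin 2 ⊕ (A.V ⊕ B.V)) :
    (graft A B).graph.Adj u v ↔ u ≠ v ∧ (GraftEdge A B u v ∨ GraftEdge A B v u) :=
  Iff.rfl

theorem graft_adj_top_top (i j : Fin 2) :
    (graft A B).graph.Adj (graftTop A B i) (graftTop A B j) ↔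
      i ≠ j := by
  refine (graft_adj A B (Sum.inl i) (Sum.inl j)).trans ?_
  constructor
  · rintro ⟨h, -⟩ rfl
    exact h rfl
  · intro h
    refine ⟨fun h' => h (Sum.inl_injective h'), ?_⟩
    fin_cases i <;> fin_cases j
    · exact absurd rfl h
    · exact Or.inl .top
    · exact Or.inr .top
    · exact absurd rfl h

theorem graft_adj_top_left (i : Fin 2) (x : A.V) :
    (graft A B).graph.Adj (graftTop A B i)
      (graftLeft A B x) ↔ i = 1 ∧ x = A.root := by
  refine (graft_adj A B (Sum.inl i) (Sum.inr (Sum.inl x))).trans ?_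
  constructor
  · rintro ⟨-, h | h⟩ <;> cases h
    exact ⟨rfl, rfl⟩
  · rintro ⟨rfl, rfl⟩
    exact ⟨Sum.inl_ne_inr, Or.inl .rootLeft⟩

theorem graft_adj_top_right (i : Fin 2) (y : B.V) :
    (graft A B).graph.Adj (graftTop A B i)
      (graftRight A B y) ↔ i = 1 ∧ y = B.root := by
  refine (graft_adj A B (Sum.inl i) (Sum.inr (Sum.inr y))).trans ?_
  constructor
  · rintro ⟨-, h | h⟩ <;> cases h
    exact ⟨rfl, rfl⟩
  · rintro ⟨rfl, rfl⟩
    exact ⟨Sum.inl_ne_inr, Or.inl .rootRight⟩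

theorem graft_adj_left_left (x x' : A.V) :
    (graft A B).graph.Adj (graftLeft A B x)
      (graftLeft A B x') ↔ A.graph.Adj x x' := by
  refine (graft_adj A B (Sum.inr (Sum.inl x)) (Sum.inr (Sum.inl x'))).trans ?_
  constructor
  · rintro ⟨-, h | h⟩
    · cases h with | left h => exact h
    · cases h with | left h => exact h.symm
  · intro h
    exact ⟨fun h' => h.ne (Sum.inl_injective (Sum.inr_injective h')), Or.inl (.left h)⟩

theorem graft_adj_right_right (y y' : B.V) :
    (graft A B).graph.Adj (graftRight A B y)
      (graftRight A B y') ↔ B.graph.Adj y y' := by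
  refine (graft_adj A B (Sum.inr (Sum.inr y)) (Sum.inr (Sum.inr y'))).trans ?_
  constructor
  · rintro ⟨-, h | h⟩
    · cases h with | right h => exact h
    · cases h with | right h => exact h.symm
  · intro h
    exact ⟨fun h' => h.ne (Sum.inr_injective (Sum.inr_injective h')), Or.inl (.right h)⟩

theorem not_graft_adj_left_right (x : A.V) (y : B.V) :
    ¬ (graft A B).graph.Adj (graftLeft A B x)
      (graftRight A B y) := by
  refine (graft_adj A B (Sum.inr (Sum.inl x)) (Sum.inr (Sum.inr y))).not.2 ?_
  rintro ⟨-, h | h⟩ <;> cases h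

end Adjacency

open Classical in
theorem degree_eq_sum (A : RootedGraph) (v : A.V) :
    A.graph.degree v = ∑ w, if A.graph.Adj v w then 1 else 0 := by
  rw [← SimpleGraph.card_neighborFinset_eq_degree, SimpleGraph.neighborFinset_eq_filter,
    card_filter]

section Degree

variable (A B : RootedGraph)

theorem degree_graft_zero :
    (graft A B).graph.degree (graftTop A B 0) = 1 := by
  rw [degree_eq_sum, sum_graft]
  simp [graft_adj_top_top, graft_adj_top_left, graft_adj_top_right]

theorem degree_graft_one :
    (graft A B).graph.degree (graftTop A B 1) = 3 := by
  classical
  rw [degree_eq_sum, sum_graft]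
  simp [graft_adj_top_top, graft_adj_top_left, graft_adj_top_right]

open Classical in
theorem degree_graft_left (x : A.V) :
    (graft A B).graph.degree (graftLeft A B x) =
      (if x = A.root then 1 else 0) + A.graph.degree x := by
  rw [degree_eq_sum, sum_graft, degree_eq_sum]
  simp [(graft A B).graph.adj_comm (graftLeft A B x)
    (graftTop A B _), graft_adj_top_left, graft_adj_left_left,
    not_graft_adj_left_right]

open Classical in
theorem degree_graft_right (y : B.V) :
    (graft A B).graph.degree (graftRight A B y) =
      (if y = B.root then 1 else 0) + B.graph.degree y := by
  rw [degree_eq_sum, sum_graft, degree_eq_sum]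
  have h : ∀ x : A.V, ¬ (graft A B).graph.Adj (graftRight A B y)
      (graftLeft A B x) :=
    fun x h => not_graft_adj_left_right A B x y h.symm
  simp [(graft A B).graph.adj_comm (graftRight A B y)
    (graftTop A B _), graft_adj_top_right, graft_adj_right_right, h]

theorem sum_degree_graft :
    ∑ v, (graft A B).graph.degree v =
      6 + (∑ x, A.graph.degree x + ∑ y, B.graph.degree y) := by
  classical
  rw [sum_graft, degree_graft_zero, degree_graft_one]
  simp only [degree_graft_left, degree_graft_right, sum_add_distrib]
  simp
  ring

theorem graft_connected (hA : A.graph.Connected) (hB : B.graph.Connected) :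
    (graft A B).graph.Connected := by
  let G := (graft A B).graph
  let one : (graft A B).V := (graftTop A B 1)
  have key : ∀ v, G.Reachable one v := by
    refine graft_cases (fun i => ?_) (fun x => ?_) (fun y => ?_)
    · by_cases h : (1 : Fin 2) = i
      · subst h
        exact SimpleGraph.Reachable.refl _
      · exact ((graft_adj_top_top A B 1 i).2 h).reachable
    · have h1 : G.Reachable one (graftLeft A B A.root) :=
        ((graft_adj_top_left A B 1 A.root).2 ⟨rfl, rfl⟩).reachable
      let f : A.graph →g G :=
        ⟨fun x => (graftLeft A B x),
          fun h => (graft_adj_left_left A B _ _).2 h⟩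
      exact h1.trans ((hA.preconnected A.root x).map f)
    · have h1 : G.Reachable one (graftRight A B B.root) :=
        ((graft_adj_top_right A B 1 B.root).2 ⟨rfl, rfl⟩).reachable
      let f : B.graph →g G :=
        ⟨fun x => (graftRight A B x),
          fun h => (graft_adj_right_right A B _ _).2 h⟩
      exact h1.trans ((hB.preconnected B.root y).map f)
  have : Nonempty (graft A B).V := ⟨one⟩
  exact ⟨fun u v => (key u).symm.trans (key v)⟩

/-- The edge count of a tree in handshake form, so that grafting only needs degree sums. -/
theorem isTree_iff_sum_degree (A : RootedGraph) :
    A.graph.IsTree ↔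
      A.graph.Connected ∧ ∑ v, A.graph.degree v + 2 = 2 * Fintype.card A.V := by
  classical
  rw [SimpleGraph.isTree_iff_connected_and_card, Nat.card_eq_fintype_card,
    Nat.card_eq_fintype_card, SimpleGraph.sum_degrees_eq_twice_card_edges,
    ← SimpleGraph.edgeFinset_card]
  refine and_congr_right fun _ => ?_
  omega

theorem graft_isTree (hA : A.graph.IsTree) (hB : B.graph.IsTree) :
    (graft A B).graph.IsTree := by
  rw [isTree_iff_sum_degree] at *
  refine ⟨graft_connected A B hA.1 hB.1, ?_⟩
  rw [sum_degree_graft, card_graft]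
  omega

theorem single_isTree : single.graph.IsTree := by
  have : Subsingleton single.V := inferInstanceAs (Subsingleton Unit)
  have : Nonempty single.V := inferInstanceAs (Nonempty Unit)
  exact SimpleGraph.IsTree.of_subsingleton

theorem degree_single (v : single.V) : single.graph.degree v = 0 := by
  rw [degree_eq_sum]
  exact sum_eq_zero fun w _ => if_neg (by exact fun h => h)

end Degree

end RootedGraph

open RootedGraph

/-! ### Order and maximum degree of the Fibonacci trees -/

theorem fibonacciTree_isTree : ∀ N : ℕ, (fibonacciTree N).graph.IsTree
  | 0 | 1 | 2 => single_isTree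
  | N + 3 => graft_isTree _ _ (fibonacciTree_isTree (N + 2)) (fibonacciTree_isTree (N + 1))

theorem card_fibonacciTree_add_two :
    ∀ N : ℕ, 1 ≤ N → Fintype.card (fibonacciTree N).V + 2 = 3 * Nat.fib N
  | 1, _ | 2, _ => rfl
  | N + 3, _ => by
    have h1 := card_fibonacciTree_add_two (N + 2) (by omega)
    have h2 := card_fibonacciTree_add_two (N + 1) (by omega)
    have h3 : Nat.fib (N + 3) = Nat.fib (N + 1) + Nat.fib (N + 2) := Nat.fib_add_two
    rw [fibonacciTree, card_graft]
    omega

theorem degree_fibonacciTree_root_le : ∀ N : ℕ,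
    (fibonacciTree N).graph.degree (fibonacciTree N).root ≤ 1
  | 0 | 1 | 2 => (degree_single _).trans_le zero_le_one
  | _ + 3 => (degree_graft_zero _ _).le

theorem RootedGraph.degree_graft_le_three {A B : RootedGraph}
    (hA : ∀ x, A.graph.degree x ≤ 3) (hB : ∀ y, B.graph.degree y ≤ 3)
    (hrA : A.graph.degree A.root ≤ 1) (hrB : B.graph.degree B.root ≤ 1) (v : (graft A B).V) :
    (graft A B).graph.degree v ≤ 3 := by
  classical
  revert v
  refine graft_cases (fun i => ?_) (fun x => ?_) (fun y => ?_)
  · fin_cases i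
    · exact (degree_graft_zero A B).trans_le (by norm_num)
    · exact (degree_graft_one A B).le
  · refine (degree_graft_left A B x).trans_le ?_
    split_ifs with h
    · subst h; omega
    · have := hA x; omega
  · refine (degree_graft_right A B y).trans_le ?_
    split_ifs with h
    · subst h; omega
    · have := hB y; omega

theorem degree_fibonacciTree_le : ∀ (N : ℕ) (v : (fibonacciTree N).V),
    (fibonacciTree N).graph.degree v ≤ 3
  | 0, v | 1, v | 2, v => (degree_single v).trans_le (by norm_num)
  | N + 3, v => degree_graft_le_three (degree_fibonacciTree_le (N + 2))
      (degree_fibonacciTree_le (N + 1)) (degree_fibonacciTree_root_le _)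
      (degree_fibonacciTree_root_le _) v

theorem maxDegree_fibonacciTree (N : ℕ) : (fibonacciTree (N + 3)).graph.maxDegree = 3 := by
  apply le_antisymm
  · exact SimpleGraph.maxDegree_le_of_forall_degree_le _ _ (degree_fibonacciTree_le _)
  · exact (degree_graft_one _ _).symm.trans_le (SimpleGraph.degree_le_maxDegree _ _)

/-! ### Signings of Fibonacci trees and their totals -/

/-- `x` is an integer combination of `F₀, …, F_{N-1}` with coefficients of total size at most `m`. -/
def IsFibCombination (N : ℕ) (m x : ℤ) : Prop :=
  ∃ b : ℕ → ℤ, x = ∑ j ∈ range N, b j * (Nat.fib j : ℤ) ∧ ∑ j ∈ range N, |b j| ≤ m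

namespace IsFibCombination

theorem zero (N : ℕ) : IsFibCombination N 0 0 := ⟨0, by simp, by simp⟩

theorem mono {N N' : ℕ} {m m' x : ℤ} (h : IsFibCombination N m x) (hN : N ≤ N') (hm : m ≤ m') :
    IsFibCombination N' m' x := by
  obtain ⟨b, hx, hb⟩ := h
  -- The coefficients beyond N are uncontrolled, so they are cut off.
  refine ⟨fun j => if j < N then b j else 0, ?_, ?_⟩
  · rw [hx]
    refine sum_subset_zero_on_sdiff (range_mono hN) (fun j hj => ?_) (fun j hj => ?_)
    · simp only [mem_sdiff, mem_range] at hj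
      simp [hj.2]
    · simp [mem_range.1 hj]
  · refine le_trans (le_of_eq ?_) (hb.trans hm)
    refine (sum_subset_zero_on_sdiff (range_mono hN) (fun j hj => ?_) (fun j hj => ?_)).symm
    · simp only [mem_sdiff, mem_range] at hj
      simp [hj.2]
    · simp [mem_range.1 hj]

theorem add {N : ℕ} {m m' x x' : ℤ} (h : IsFibCombination N m x) (h' : IsFibCombination N m' x') :
    IsFibCombination N (m + m') (x + x') := by
  obtain ⟨b, rfl, hb⟩ := h
  obtain ⟨b', rfl, hb'⟩ := h'
  refine ⟨b + b', by simp [add_mul, sum_add_distrib], ?_⟩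
  refine le_trans ?_ (add_le_add hb hb')
  rw [← sum_add_distrib]
  exact sum_le_sum fun j _ => abs_add_le _ _

theorem mul_fib {N j : ℕ} (hj : j < N) (t : ℤ) : IsFibCombination N |t| (t * Nat.fib j) := by
  refine ⟨fun i => if i = j then t else 0, ?_, ?_⟩
  · simp [hj]
  · simp [apply_ite abs, hj]

end IsFibCombination

/-- The values `±1` (and `0` for exceptional vertices) alternate along the edges of `A` that join
two nonexceptional vertices. -/
structure IsPartialSigning (A : RootedGraph) (σ : A.V → ℤ) : Prop where
  values : ∀ v, σ v = 0 ∨ σ v = 1 ∨ σ v = -1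
  alternate : ∀ u v, A.graph.Adj u v → σ u ≠ 0 → σ v ≠ 0 → σ v = -σ u

/-- The number of exceptional vertices. -/
def zeroCount (A : RootedGraph) (σ : A.V → ℤ) : ℤ := ∑ v, if σ v = 0 then 1 else 0

/-- The total of a signing differs from `± F_N` by twice a short combination of Fibonacci numbers,
up to a small error. -/
def HasFibExpansion (A : RootedGraph) (N : ℕ) (σ : A.V → ℤ) : Prop :=
  ∀ s : ℤ, (s = 1 ∨ s = -1) → (σ A.root ≠ 0 → s = σ A.root) →
    ∃ x e : ℤ, IsFibCombination N (2 * zeroCount A σ) x ∧ |e| ≤ zeroCount A σ ∧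
      ∑ v, σ v = s * Nat.fib N + 2 * x + e

theorem sum_single {M : Type*} [AddCommMonoid M] (f : single.V → M) :
    ∑ v, f v = f single.root :=
  have : Subsingleton single.V := inferInstanceAs (Subsingleton Unit)
  Fintype.sum_subsingleton f single.root

theorem hasFibExpansion_single {N : ℕ} (hN : Nat.fib N = 1) (σ : single.V → ℤ) :
    HasFibExpansion single N σ := by
  intro s hs hroot
  have hz : zeroCount single σ = if σ single.root = 0 then 1 else 0 := sum_single _
  have hsum : ∑ v, σ v = σ single.root := sum_single _
  rw [hz, hsum, hN]
  by_cases h : σ single.root = 0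
  -- An exceptional single vertex has total 0, so the error must absorb the ±F_N = ±1.
  · refine ⟨0, -s, (IsFibCombination.zero N).mono le_rfl (by simp [h]), ?_, ?_⟩
    · rcases hs with rfl | rfl <;> simp [h]
    · rw [h]; push_cast; ring
  · refine ⟨0, 0, (IsFibCombination.zero N).mono le_rfl (by simp [h]), by simp [h], ?_⟩
    rw [hroot h]; push_cast; ring

/-- If u₁ and u₂ are nonexceptional they cancel, and the subtrees continue with sign s, which gives
F_{N+3} = F_{N+2} + F_{N+1}. Otherwise a subtree may start with the opposite sign, at the cost of
±2F_{N+2} or ±2F_{N+1}. The two subtrees account for the factor 2 in front of `zeroCount`. -/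
theorem hasFibExpansion_graft {A B : RootedGraph} {N : ℕ} {σ : (graft A B).V → ℤ}
    (hσ : IsPartialSigning (graft A B) σ)
    (hA : HasFibExpansion A (N + 2) fun x => σ (graftLeft A B x))
    (hB : HasFibExpansion B (N + 1) fun y => σ (graftRight A B y)) :
    HasFibExpansion (graft A B) (N + 3) σ := by
  intro s hs hroot
  set σ₁ : ℤ := σ (graftTop A B 0) with h₁
  set σ₂ : ℤ := σ (graftTop A B 1) with h₂
  set α : ℤ := σ (graftLeft A B A.root) with hα
  set β : ℤ := σ (graftRight A B B.root) with hβ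
  have v₁ : σ₁ = 0 ∨ σ₁ = 1 ∨ σ₁ = -1 := hσ.values _
  have v₂ : σ₂ = 0 ∨ σ₂ = 1 ∨ σ₂ = -1 := hσ.values _
  have vα : α = 0 ∨ α = 1 ∨ α = -1 := hσ.values _
  have vβ : β = 0 ∨ β = 1 ∨ β = -1 := hσ.values _
  have hroot' : σ₁ ≠ 0 → s = σ₁ := hroot
  have a₁₂ : σ₁ ≠ 0 → σ₂ ≠ 0 → σ₂ = -σ₁ :=
    hσ.alternate _ _ ((graft_adj_top_top A B 0 1).2 (by decide))
  have a₂α : σ₂ ≠ 0 → α ≠ 0 → α = -σ₂ :=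
    hσ.alternate _ _ ((graft_adj_top_left A B 1 A.root).2 ⟨rfl, rfl⟩)
  have a₂β : σ₂ ≠ 0 → β ≠ 0 → β = -σ₂ :=
    hσ.alternate _ _ ((graft_adj_top_right A B 1 B.root).2 ⟨rfl, rfl⟩)
  set z : ℤ := (if σ₁ = 0 then 1 else 0) + if σ₂ = 0 then 1 else 0 with hz
  -- Here s + 2t is the sign used for a subtree whose root has value γ. It can stay s when γ = 0; a
  -- flip t = ±1 requires u₁ or u₂ to be exceptional.
  have hchoice : ∀ γ : ℤ, (γ = 0 ∨ γ = 1 ∨ γ = -1) → (σ₂ ≠ 0 → γ ≠ 0 → γ = -σ₂) →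
      ∃ t : ℤ, (s + 2 * t = 1 ∨ s + 2 * t = -1) ∧ (γ ≠ 0 → s + 2 * t = γ) ∧ |t| ≤ z := by
    intro γ hγ hγ₂
    by_cases hγ0 : γ = 0
    · exact ⟨0, by simpa using hs, fun h => absurd hγ0 h, by rw [hz]; simp; positivity⟩
    · by_cases hz0 : σ₁ ≠ 0 ∧ σ₂ ≠ 0
      · refine ⟨0, by simpa using hs, fun h => ?_, by rw [hz]; simp; positivity⟩
        rw [hγ₂ hz0.2 h, a₁₂ hz0.1 hz0.2, hroot' hz0.1]
        ring
      · have hz1 : 1 ≤ z := by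
          rw [hz]
          split_ifs <;> omega
        rcases hs with rfl | rfl <;> rcases hγ with rfl | rfl | rfl
        · exact absurd rfl hγ0
        · exact ⟨0, by simp, by simp, by simpa using by linarith⟩
        · exact ⟨-1, by simp, by simp, by simpa using hz1⟩
        · exact absurd rfl hγ0
        · exact ⟨1, by simp, by simp, by simpa using hz1⟩
        · exact ⟨0, by simp, by simp, by simpa using by linarith⟩
  obtain ⟨t, ht, htα, htz⟩ := hchoice α vα a₂α
  obtain ⟨u, hu, huβ, huz⟩ := hchoice β vβ a₂β
  obtain ⟨x, e, hx, he, hxe⟩ := hA _ ht fun h => htα h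
  obtain ⟨y, f, hy, hf, hyf⟩ := hB _ hu fun h => huβ h
  set mA := zeroCount A fun x => σ (graftLeft A B x) with hmA
  set mB := zeroCount B fun y => σ (graftRight A B y) with hmB
  have hm : zeroCount (graft A B) σ = z + (mA + mB) := sum_graft A B _
  have h12 : |σ₁ + σ₂| ≤ z := by
    rw [hz]
    by_cases c₁ : σ₁ = 0 <;> by_cases c₂ : σ₂ = 0
    · simp [c₁, c₂]
    · rcases v₂ with h | h | h <;> simp [c₁, h]
    · rcases v₁ with h | h | h <;> simp [c₂, h]
    · simp [c₁, a₁₂ c₁ c₂]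
  refine ⟨t * Nat.fib (N + 2) + u * Nat.fib (N + 1) + (x + y), σ₁ + σ₂ + (e + f), ?_, ?_, ?_⟩
  · rw [hm]
    refine (((IsFibCombination.mul_fib (by omega) t).add
      (IsFibCombination.mul_fib (by omega) u)).add
      ((hx.mono (by omega) le_rfl).add (hy.mono (by omega) le_rfl))).mono le_rfl ?_
    linarith
  · rw [hm]
    exact (abs_add_le _ _).trans
      (add_le_add h12 ((abs_add_le _ _).trans (add_le_add he hf)))
  · have hfib : Nat.fib (N + 3) = Nat.fib (N + 1) + Nat.fib (N + 2) := Nat.fib_add_two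
    rw [sum_graft, hxe, hyf, hfib]
    push_cast
    ring

theorem hasFibExpansion_fibonacciTree : ∀ (N : ℕ) (σ : (fibonacciTree (N + 1)).V → ℤ),
    IsPartialSigning (fibonacciTree (N + 1)) σ → HasFibExpansion (fibonacciTree (N + 1)) (N + 1) σ
  | 0, σ, _ => hasFibExpansion_single rfl σ
  | 1, σ, _ => hasFibExpansion_single rfl σ
  | N + 2, _, hσ => hasFibExpansion_graft hσ
      (hasFibExpansion_fibonacciTree (N + 1) _
        ⟨fun _ => hσ.values _, fun _ _ h => hσ.alternate _ _ ((graft_adj_left_left _ _ _ _).2 h)⟩)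
      (hasFibExpansion_fibonacciTree N _
        ⟨fun _ => hσ.values _, fun _ _ h => hσ.alternate _ _ ((graft_adj_right_right _ _ _ _).2 h)⟩)

/-- A nearly balanced partial signing of a Fibonacci tree has many exceptional vertices. -/
theorem le_zeroCount_of_balanced {N : ℕ} (hN : 2 ≤ N) {σ : (fibonacciTree N).V → ℤ}
    (hσ : IsPartialSigning (fibonacciTree N) σ)
    (hbal : |∑ v, σ v| ≤ zeroCount (fibonacciTree N) σ) :
    (N : ℤ) ≤ 27 * zeroCount (fibonacciTree N) σ + 6 := by
  obtain ⟨M, rfl⟩ : ∃ M, N = M + 1 := ⟨N - 1, by omega⟩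
  have hroot := hσ.values (fibonacciTree (M + 1)).root
  obtain ⟨s, hs, hsr⟩ : ∃ s : ℤ, (s = 1 ∨ s = -1) ∧
      (σ (fibonacciTree (M + 1)).root ≠ 0 → s = σ (fibonacciTree (M + 1)).root) := by
    rcases hroot with h | h
    · exact ⟨1, Or.inl rfl, fun h' => absurd h h'⟩
    · exact ⟨_, h, fun _ => rfl⟩
  obtain ⟨x, e, ⟨b, rfl, hb⟩, he, hsum⟩ := hasFibExpansion_fibonacciTree M σ hσ s hs hsr
  set m := zeroCount (fibonacciTree (M + 1)) σ
  set E : ℤ := e - ∑ v, σ v with hE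
  have hEm : |E| ≤ 2 * m := (abs_sub _ _).trans (by linarith)
  -- The whole error is placed on F₁ = 1, where parity is unrestricted.
  let b' : ℕ → ℤ := fun i => if i = M + 1 then s else 2 * b i + if i = 1 then E else 0
  have hb'top : b' (M + 1) = s := if_pos rfl
  have hb' : ∀ i ∈ range (M + 1), b' i = 2 * b i + if i = 1 then E else 0 := fun i hi =>
    if_neg (mem_range.1 hi).ne
  have h1 : 1 ∈ range (M + 1) := mem_range.2 (by omega)
  have key := length_le_of_fib_relation b' (M + 1) ?_ ?_ ?_
  · rw [sum_range_succ, hb'top] at key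
    -- The doubled combination contributes 4m and the error E at most 2m.
    have hle : ∑ i ∈ range (M + 1), |b' i| ≤ 6 * m := by
      have : ∑ i ∈ range (M + 1), |b' i| ≤
          ∑ i ∈ range (M + 1), (2 * |b i| + if i = 1 then |E| else 0) := by
        refine sum_le_sum fun i hi => ?_
        rw [hb' i hi]
        refine (abs_add_le _ _).trans (add_le_add ?_ ?_)
        · rw [abs_mul, abs_two]
        · split_ifs <;> simp
      refine this.trans ?_
      rw [sum_add_distrib, ← mul_sum, sum_ite_eq', if_pos h1]
      linarith
    have hs1 : |s| = 1 := by rcases hs with rfl | rfl <;> simp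
    rw [hs1] at key
    push_cast at key ⊢
    omega
  · rw [hb'top]
    rcases hs with rfl | rfl <;> decide
  · intro i hi hiM
    rw [hb' i (mem_range.2 hiM), if_neg (by omega), add_zero]
    exact even_two_mul _
  · rw [sum_range_succ, hb'top]
    have : ∑ i ∈ range (M + 1), b' i * (Nat.fib i : ℤ) =
        2 * ∑ i ∈ range (M + 1), b i * (Nat.fib i : ℤ) + E := by
      rw [mul_sum]
      have hE1 : E = ∑ i ∈ range (M + 1), if i = 1 then E else 0 := by
        rw [sum_ite_eq', if_pos h1]
      conv_rhs => rw [hE1, ← sum_add_distrib]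
      refine sum_congr rfl fun i hi => ?_
      rw [hb' i hi]
      split_ifs with h
      · subst h; simp
      · ring
    rw [this, hE, hsum]
    ring

/-! ### From colorings to signings -/

theorem card_filter_mem_le {V : Type*} [Fintype V] {c : V → ℕ} (hc : Function.Injective c)
    (S : Finset ℕ) : #{v | c v ∈ S} ≤ #S :=
  card_le_card_of_injOn c (fun v hv => by simpa using hv) hc.injOn

theorem fibonacciTree_length_le {N : ℕ} (hN : 2 ≤ N) {k lam : ℕ}
    (hlam : lam = Fintype.card (fibonacciTree N).V / 2) {c : (fibonacciTree N).V → ℕ}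
    (hc : IsBackboneColoring ⊤ (fibonacciTree N).graph lam c) (hk : ∀ v, c v ≤ k) :
    (N : ℤ) ≤ 27 * ((k : ℤ) - Fintype.card (fibonacciTree N).V + 1) + 6 := by
  have hinj : Function.Injective c := fun u v h => by
    by_contra huv
    exact hc.proper u v huv h
  have hcard : ∀ S : Finset ℕ, (∑ v, if c v ∈ S then (1 : ℤ) else 0) ≤ #S := fun S => by
    rw [← natCast_card_filter]
    exact_mod_cast card_filter_mem_le hinj S
  set n := Fintype.card (fibonacciTree N).V with hn
  -- This gives 2λ ≤ n ≤ k, so the two extreme color blocks are disjoint and `k - lam` does not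
  -- truncate.
  have hnk : n ≤ k := by
    have h := hcard (Icc 1 k)
    rw [sum_congr rfl fun v _ => if_pos (mem_Icc.2 ⟨hc.pos v, hk v⟩)] at h
    simpa [← hn] using h
  let σ : (fibonacciTree N).V → ℤ := fun v =>
    (if c v ∈ Icc 1 lam then 1 else 0) - if c v ∈ Ioc (k - lam) k then 1 else 0
  have hσ_eq : ∀ v, σ v = if c v ≤ lam then 1 else if k - lam < c v then -1 else 0 := by
    intro v
    have h1 := hc.pos v
    have h2 := hk v
    simp only [σ, mem_Icc, mem_Ioc]
    split_ifs <;> omega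
  have hσ : IsPartialSigning (fibonacciTree N) σ := by
    constructor
    · intro v
      rw [hσ_eq]
      split_ifs <;> simp
    · intro u v huv
      have hd := hc.backbone u v huv
      have := hc.pos u
      have := hc.pos v
      have := hk u
      have := hk v
      rw [hσ_eq, hσ_eq]
      rw [le_abs] at hd
      split_ifs <;> omega
  have hzero : zeroCount (fibonacciTree N) σ =
      ∑ v, if c v ∈ Ioc lam (k - lam) then (1 : ℤ) else 0 := by
    refine sum_congr rfl fun v _ => if_congr ?_ rfl rfl
    rw [hσ_eq, mem_Ioc]
    split_ifs <;> simp <;> omega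
  have hL := hcard (Icc 1 lam)
  have hR := hcard (Ioc (k - lam) k)
  have hM := hcard (Ioc lam (k - lam))
  rw [← hzero] at hM
  have hpart : (∑ v, if c v ∈ Icc 1 lam then (1 : ℤ) else 0) +
      (∑ v, if c v ∈ Ioc (k - lam) k then (1 : ℤ) else 0) +
      zeroCount (fibonacciTree N) σ = n := by
    rw [hzero, ← sum_add_distrib, ← sum_add_distrib, hn, Fintype.card_eq_sum_ones]
    push_cast
    refine sum_congr rfl fun v _ => ?_
    have h1 := hc.pos v
    have h2 := hk v
    simp only [mem_Icc, mem_Ioc]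
    split_ifs <;> omega
  have hdiff : ∑ v, σ v = (∑ v, if c v ∈ Icc 1 lam then (1 : ℤ) else 0) -
      ∑ v, if c v ∈ Ioc (k - lam) k then (1 : ℤ) else 0 := sum_sub_distrib _ _
  rw [Nat.card_Icc] at hL
  rw [Nat.card_Ioc] at hR hM
  -- Each extreme block holds at most λ vertices, hence at least n - m - λ, and 2λ ≤ n.
  have hbal : |∑ v, σ v| ≤ zeroCount (fibonacciTree N) σ := by
    rw [hdiff, abs_le]
    omega
  have := le_zeroCount_of_balanced hN hσ hbal
  omega

theorem card_fibonacciTree_le_backboneChromaticNumber (N lam : ℕ) :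
    Fintype.card (fibonacciTree N).V ≤ backboneChromaticNumber ⊤ (fibonacciTree N).graph lam := by
  obtain ⟨c, hc, hk⟩ := backboneChromaticNumber_attained ⊤ (fibonacciTree N).graph le_top lam
  have h := card_le_card_of_injOn (s := univ) (t := Icc 1 _) c
    (fun v _ => by simpa using ⟨hc.pos v, hk v⟩)
    (fun u _ v _ h => by
      by_contra huv
      exact hc.proper u v huv h)
  simpa using h

/-! ### From N to log n -/

theorem fib_le_goldenRatio_pow (n : ℕ) : (Nat.fib n : ℝ) ≤ goldenRatio ^ n := by
  have h := fib_succ_sub_goldenConj_mul_fib n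
  have h1 : (Nat.fib n : ℝ) ≤ Nat.fib (n + 1) := by exact_mod_cast Nat.fib_le_fib_succ
  nlinarith [goldenConj_neg, Nat.cast_nonneg (α := ℝ) (Nat.fib n)]

theorem logb_card_fibonacciTree_le {N : ℕ} (hN : 1 ≤ N) :
    logb goldenRatio (Fintype.card (fibonacciTree N).V) ≤ N + 3 := by
  have hpos : 0 < Fintype.card (fibonacciTree N).V :=
    Fintype.card_pos_iff.2 ⟨(fibonacciTree N).root⟩
  have hcard := card_fibonacciTree_add_two N hN
  have h3 : (3 : ℝ) ≤ goldenRatio ^ 3 := by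
    nlinarith [goldenRatio_sq, one_lt_goldenRatio]
  rw [logb_le_iff_le_rpow one_lt_goldenRatio (by exact_mod_cast hpos)]
  have : ((N : ℝ) + 3) = ((N + 3 : ℕ) : ℝ) := by push_cast; ring
  rw [this, rpow_natCast, pow_add]
  have hc : (Fintype.card (fibonacciTree N).V : ℝ) ≤ 3 * Nat.fib N := by
    exact_mod_cast (by omega : Fintype.card (fibonacciTree N).V ≤ 3 * Nat.fib N)
  have := fib_le_goldenRatio_pow N
  nlinarith [pow_pos goldenRatio_pos N]

theorem backboneChromaticNumber_fibonacciTree_ge {N : ℕ} (hN : 2 ≤ N) {n lam : ℕ}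
    (hn : n = Fintype.card (fibonacciTree N).V) (hlam : lam = n / 2) :
    max (n : ℝ) (2 * (lam : ℝ)) + 1 / 48 * logb goldenRatio (n : ℝ) - 3 ≤
      (backboneChromaticNumber ⊤ (fibonacciTree N).graph lam : ℝ) := by
  subst hn
  obtain ⟨c, hc, hk⟩ := backboneChromaticNumber_attained ⊤ (fibonacciTree N).graph le_top lam
  have h1 := fibonacciTree_length_le hN hlam hc hk
  have h2 := card_fibonacciTree_le_backboneChromaticNumber N lam
  set k := backboneChromaticNumber ⊤ (fibonacciTree N).graph lam
  have h3 := logb_card_fibonacciTree_le (N := N) (by omega)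
  have hmax : max (Fintype.card (fibonacciTree N).V : ℝ) (2 * (lam : ℝ)) =
      Fintype.card (fibonacciTree N).V := by
    apply max_eq_left
    exact_mod_cast (by omega : 2 * lam ≤ Fintype.card (fibonacciTree N).V)
  have h1' : (N : ℝ) ≤ 27 * ((k : ℝ) - Fintype.card (fibonacciTree N).V + 1) + 6 := by
    exact_mod_cast h1
  have h2' : (Fintype.card (fibonacciTree N).V : ℝ) ≤ k := by exact_mod_cast h2
  rw [hmax]
  -- Weights 27/48 on `h1'` and 21/48 on `h2'` give k - n ≥ N/48 - 33/48, and log_φ n ≤ N + 3.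
  linarith

theorem le_card_fibonacciTree {N : ℕ} (hN : 5 ≤ N) : N ≤ Fintype.card (fibonacciTree N).V := by
  have h1 := Nat.le_fib_self hN
  have h2 := card_fibonacciTree_add_two N (by omega)
  omega

theorem fibonacciTree_iso_injective {M N : ℕ} (hM : 2 ≤ M) (hN : 2 ≤ N)
    (h : Nonempty ((fibonacciTree M).graph ≃g (fibonacciTree N).graph)) : M = N := by
  obtain ⟨e⟩ := h
  have h0 := Fintype.card_congr e.toEquiv
  have h1 := card_fibonacciTree_add_two M (by omega)
  have h2 := card_fibonacciTree_add_two N (by omega)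
  exact Nat.fib_strictMonoOn.injOn (Set.mem_Ici.2 hM) (Set.mem_Ici.2 hN) (by omega)

theorem eventually_log_loss : ∃ N₀ : ℕ, ∀ N : ℕ, N₀ ≤ N →
    ∀ n lam : ℕ, n = Fintype.card (fibonacciTree N).V → lam = n / 2 →
      1 / 96 * log (n : ℝ) ≤
        (backboneChromaticNumber ⊤ (fibonacciTree N).graph lam : ℝ) -
          max (n : ℝ) (2 * (lam : ℝ)) := by
  obtain ⟨N₀, hN₀⟩ := Filter.eventually_atTop.1
    -- The threshold 288 = 3 · 96 lets half of the coefficient 1/48 absorb the loss of 3.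
    ((tendsto_log_atTop.comp tendsto_natCast_atTop_atTop).eventually_ge_atTop (288 : ℝ))
  refine ⟨max N₀ 5, fun N hN n lam hn hlam => ?_⟩
  have hNn : N ≤ n := hn ▸ le_card_fibonacciTree (le_of_max_le_right hN)
  have hlog : 288 ≤ log (n : ℝ) := hN₀ n ((le_of_max_le_left hN).trans hNn)
  have hb := backboneChromaticNumber_fibonacciTree_ge (by omega) hn hlam
  have hle : log (n : ℝ) ≤ logb goldenRatio n := by
    rw [logb, le_div_iff₀ (log_pos one_lt_goldenRatio)]
    have : log goldenRatio ≤ 1 := by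
      have := log_le_sub_one_of_pos goldenRatio_pos
      linarith [goldenRatio_lt_two]
    nlinarith
  linarith

end Auxiliary

theorem mainTheorem2 :
    (∀ N : ℕ, 96 ≤ N →
      (fibonacciTree N).graph.IsTree ∧
      Fintype.card (fibonacciTree N).V + 2 = 3 * Nat.fib N ∧
      (fibonacciTree N).graph.maxDegree = 3 ∧
      ∀ n lam : ℕ, n = Fintype.card (fibonacciTree N).V → lam = n / 2 →
        max (n : ℝ) (2 * (lam : ℝ)) + 1 / 48 * Real.logb Real.goldenRatio (n : ℝ) - 3 ≤
          (backboneChromaticNumber (⊤ : SimpleGraph (fibonacciTree N).V)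
            (fibonacciTree N).graph lam : ℝ)) ∧
    (∀ M N : ℕ, 96 ≤ M → 96 ≤ N →
      Nonempty ((fibonacciTree M).graph ≃g (fibonacciTree N).graph) → M = N) ∧
    ∃ C : ℝ, 0 < C ∧ ∃ N₀ : ℕ, ∀ N : ℕ, N₀ ≤ N →
      ∀ n lam : ℕ, n = Fintype.card (fibonacciTree N).V → lam = n / 2 →
        C * Real.log (n : ℝ) ≤
          (backboneChromaticNumber (⊤ : SimpleGraph (fibonacciTree N).V)
            (fibonacciTree N).graph lam : ℝ) - max (n : ℝ) (2 * (lam : ℝ)) := by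
  refine ⟨fun N hN => ⟨fibonacciTree_isTree N, card_fibonacciTree_add_two N (by omega), ?_,
    fun n lam hn hlam => backboneChromaticNumber_fibonacciTree_ge (by omega) hn hlam⟩,
    fun M N hM hN => fibonacciTree_iso_injective (by omega) (by omega),
    1 / 96, by norm_num, eventually_log_loss⟩
  obtain ⟨M, rfl⟩ := Nat.exists_eq_add_of_le' (show 3 ≤ N by omega)
  exact maxDegree_fibonacciTree M
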